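/- Binary strings are identified with natural numbers via the length-lexicographic correspondence $\lambda\mapsto 0,\ 0\mapsto 1,\ 1\mapsto 2,\ 00\mapsto 3,\dots$ For a partial recursive $U:\{0,1\}^*\times\{0,1\}^*\rightharpoonup\{0,1\}^*\cup\{\perp\}$, $x\in\{0,1\}^*$ and $A\subseteq\{0,1\}^*$ with characteristic function $\chi_A$, let $C_U(x)=\min\{l(p): U(p,\lambda)=x\}$, where $l(p)$ is the length of $p$. A partial function $f$ is $A$-consistent if $f(z)\in\{\chi_A(z),\perp\}$ for all $z\in\mathrm{dom}(f)$. Let $$ic_U(x:A)=\min\{l(p): \lambda z.\,U(p,z)\text{ is total and }A\text{-consistent, and } U(p,x)=\chi_A(x)\},$$ and let $\overline{ic}_U(x:A)$ be defined in the same way without requiring totality (all minima are $\infty$ if no such $p$ exists). Call $U$ optimal if for every partial recursive $U'$ there is a constant $c$ such that $C_U(x)\le C_{U'}(x)+c$, $ic_U(x:A)\le ic_{U'}(x:A)+c$ and $\overline{ic}_U(x:A)\le\overline{ic}_{U'}(x:A)+c$ for all $x$ and $A$. Let $W_e$ be the domain of the $e$-th partial recursive function and $K=\{e: e\in W_e\}$.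 A set $A$ is Q-complete if it is r.e. and there is a recursive function $g$ such that, for all $x$, $x\in K\Leftrightarrow W_{g(x)}\subseteq A$. Theorem. Let $U$ be optimal, and write $C$, $ic$, $\overline{ic}$ for $C_U$, $ic_U$, $\overline{ic}_U$. Every Q-complete set $A$ has hard instances, even with respect to $\overline{ic}$: there is a constant $c$ such that $ic(x:A)\ge C(x)-c$ for infinitely many $x$, and there is a constant $c$ such that $\overline{ic}(x:A)\ge C(x)-c$ for infinitely many $x$. -/

import Mathlib

/-- The position of a binary string in the length-lexicographic order, i.e. the canonical
correspondence `λ ↦ 0, 0 ↦ 1, 1 ↦ 2, 00 ↦ 3, 01 ↦ 4, 10 ↦ 5, 11 ↦ 6, 000 ↦ 7, …`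
between binary strings and natural numbers. -/
def strNum (x : List Bool) : ℕ :=
  x.foldl (fun n b => 2 * n + 1 + b.toNat) 0

theorem strNum_append_singleton (x : List Bool) (b : Bool) :
    strNum (x ++ [b]) = 2 * strNum x + 1 + b.toNat := by
  simp [strNum]

theorem strNum_bijective : Function.Bijective strNum := by
  constructor
  · intro x
    induction x using List.reverseRecOn with
    | nil =>
      intro y h
      rcases List.eq_nil_or_concat y with rfl | ⟨y', b, rfl⟩
      · rfl
      · rw [List.concat_eq_append, strNum_append_singleton] at h
        have h0 : strNum [] = 0 := rfl
        omega
    | append_singleton x a ih =>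
      intro y h
      rcases List.eq_nil_or_concat y with rfl | ⟨y', b, rfl⟩
      · rw [strNum_append_singleton] at h
        have h0 : strNum [] = 0 := rfl
        omega
      · rw [List.concat_eq_append] at h ⊢
        rw [strNum_append_singleton, strNum_append_singleton] at h
        have hab : a = b := by
          cases a <;> cases b <;> simp at h ⊢ <;> omega
        subst hab
        have hxy : strNum x = strNum y' := by omega
        rw [ih hxy]
  · intro n
    induction n using Nat.strong_induction_on with
    | _ n ih =>
      rcases Nat.eq_zero_or_pos n with rfl | hn
      · exact ⟨[], rfl⟩
      · obtain ⟨x, hx⟩ := ih ((n - 1) / 2) (by omega)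
        rcases Nat.mod_two_eq_zero_or_one (n - 1) with h | h
        · refine ⟨x ++ [false], ?_⟩
          rw [strNum_append_singleton, hx]
          simp only [Bool.toNat_false]
          omega
        · refine ⟨x ++ [true], ?_⟩
          rw [strNum_append_singleton, hx]
          simp only [Bool.toNat_true]
          omega

/-- An interpreter: `U p z` is the result, if any, of running the program `p` on the input `z`;
the value `none : Option (List Bool)` is the "don't know" output `⊥`. -/
abbrev Interpreter : Type := List Bool → List Bool →. Option (List Bool)

/-- The characteristic function of `A`, with values the one-letter strings `0` and `1`. -/
noncomputable def chi (A : Set (List Bool)) (x : List Bool) : List Bool :=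
  open Classical in if x ∈ A then [true] else [false]

/-- A partial function is `A`-consistent if each of its values is either `⊥` or correct. -/
def IsConsistent (A : Set (List Bool)) (f : List Bool →. Option (List Bool)) : Prop :=
  ∀ z, ∀ v ∈ f z, v = some (chi A z) ∨ v = none

/-- Kolmogorov complexity `C_U(x)` of `x` in `U`; it is `⊤` if no program produces `x`. -/
noncomputable def kolmogorov (U : Interpreter) (x : List Bool) : ℕ∞ :=
  ⨅ p ∈ {p : List Bool | some x ∈ U p []}, (p.length : ℕ∞)

/-- Instance complexity `ic_U(x : A)`: the programs are total. -/
noncomputable def instComplexity (U : Interpreter) (A : Set (List Bool)) (x : List Bool) : ℕ∞ :=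
  ⨅ p ∈ {p : List Bool | (∀ z, (U p z).Dom) ∧ IsConsistent A (U p) ∧ some (chi A x) ∈ U p x},
    (p.length : ℕ∞)

/-- The weak instance complexity: as `instComplexity`, but programs need not be total. -/
noncomputable def weakInstComplexity (U : Interpreter) (A : Set (List Bool)) (x : List Bool) :
    ℕ∞ :=
  ⨅ p ∈ {p : List Bool | IsConsistent A (U p) ∧ some (chi A x) ∈ U p x}, (p.length : ℕ∞)

/-- `U` is partial recursive and, up to an additive constant, optimal for Kolmogorov complexity
and for both kinds of instance complexity. -/
def IsOptimal (U : Interpreter) : Prop :=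
  Partrec₂ U ∧ ∀ U' : Interpreter, Partrec₂ U' → ∃ c : ℕ, ∀ (x : List Bool) (A : Set (List Bool)),
    kolmogorov U x ≤ kolmogorov U' x + c ∧
    instComplexity U A x ≤ instComplexity U' A x + c ∧
    weakInstComplexity U A x ≤ weakInstComplexity U' A x + c

/-- `A` has hard instances: for some constant `c`, `C(x) - c ≤ ic(x : A)` for infinitely many
`x`. -/
def HasHardInstances (U : Interpreter) (A : Set (List Bool)) : Prop :=
  ∃ c : ℕ, {x : List Bool | kolmogorov U x ≤ instComplexity U A x + c}.Infinite

/-- `A` has hard instances with respect to the weak instance complexity. -/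
def HasWeakHardInstances (U : Interpreter) (A : Set (List Bool)) : Prop :=
  ∃ c : ℕ, {x : List Bool | kolmogorov U x ≤ weakInstComplexity U A x + c}.Infinite

/-- `W_e`, the domain of the `e`-th partial recursive function. -/
def reSet (e : ℕ) : Set ℕ :=
  {n | ((Denumerable.ofNat Nat.Partrec.Code e).eval n).Dom}

/-- The diagonal halting set `K = {e | e ∈ W_e}`. -/
def diagK : Set ℕ := {e | e ∈ reSet e}

/-- `A` is Q-complete: it is r.e. and `x ∈ K ↔ W_{g(x)} ⊆ A` for some recursive `g`, where `A` is
viewed as a set of natural numbers. -/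
def IsQComplete (A : Set (List Bool)) : Prop :=
  REPred (fun x => x ∈ A) ∧
    ∃ g : ℕ → ℕ, Computable g ∧ ∀ e, e ∈ diagK ↔ reSet (g e) ⊆ strNum '' A

namespace InstanceComplexity

/-- The state of the construction: the records `(i, k, n)` of the processes (latest first), the
list of killed tokens, and the assignments `(p, y, i)` of elements `y` to programs `p`. -/
abbrev State : Type := List (ℕ × ℕ × ℕ) × List ℕ × List (ℕ × ℕ × ℕ)

/-- The current round and position of process `i`. -/
def record (σ : State) (i : ℕ) : ℕ × ℕ := (σ.1.lookup i).getD (0, 0)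

/-- The current token of process `i`. -/
def tok (σ : State) (i : ℕ) : ℕ := Nat.pair i (record σ i).1

/-- The current candidate of process `i`, when token `t` owns the enumeration `w t`. -/
def cand (w : ℕ → ℕ → Option ℕ) (σ : State) (i : ℕ) : Option ℕ := w (tok σ i) (record σ i).2

/-- Process `i` gives up its current candidate. -/
def advance (σ : State) (i : ℕ) : State :=
  ((i, if tok σ i ∈ σ.2.1 then ((record σ i).1 + 1, 0) else ((record σ i).1, (record σ i).2 + 1)) :: σ.1,
    σ.2)

/-- Token `t` is killed. -/
def kill (σ : State) (t : ℕ) : State := (σ.1, t :: σ.2.1, σ.2.2)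

/-- Program `p` is assigned to the element `y` on behalf of process `i`. -/
def assign (σ : State) (p y i : ℕ) : State := (σ.1, σ.2.1, (p, y, i) :: σ.2.2)

/-- The reaction of process `i` to the discovery that program `p` covers its candidate `y`. -/
def react (w : ℕ → ℕ → Option ℕ) (σ : State) (i p y : ℕ) : State :=
  if p < i then kill σ (tok σ i)
  else if ∃ a ∈ σ.2.2, a.2.1 = y ∧ a.1 ≤ p then σ
  else (σ.2.2.lookup p).elim (assign σ p y i) fun b =>
    if cand w σ b.2 = some b.1 then kill σ (if i < b.2 then tok σ b.2 else tok σ i) else σ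

/-- One stage of the construction. -/
def step (inA : ℕ → ℕ → Bool) (cov : ℕ → ℕ → ℕ → Bool) (dead : ℕ → ℕ → Bool)
    (w : ℕ → ℕ → Option ℕ) (s : ℕ) (σ : State) : State :=
  (cand w σ s.unpair.1).elim (advance σ s.unpair.1) fun y =>
    if inA s y then advance σ s.unpair.1
    else if tok σ s.unpair.1 ∉ σ.2.1 ∧ ¬ dead s s.unpair.2.unpair.1 ∧
        cov s s.unpair.2.unpair.1 y then
      react w σ s.unpair.1 s.unpair.2.unpair.1 y
    else σ

/-- The state before stage `s`. -/
def run (inA : ℕ → ℕ → Bool) (cov : ℕ → ℕ → ℕ → Bool) (dead : ℕ → ℕ → Bool)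
    (w : ℕ → ℕ → Option ℕ) (s : ℕ) : State :=
  s.rec ([], [], []) fun n σ => step inA cov dead w n σ

section Lookup

theorem mem_of_lookup_eq_some {β : Type*} {l : List (ℕ × β)} {p : ℕ} {b : β}
    (h : l.lookup p = some b) : (p, b) ∈ l := by
  induction l with
  | nil => simp at h
  | cons a l ih =>
    rw [List.lookup_cons] at h
    by_cases hp : p = a.1
    · subst hp
      simp at h
      subst h
      simp
    · have : (p == a.1) = false := by simpa using hp
      rw [this] at h
      exact List.mem_cons_of_mem _ (ih (by simpa using h))

theorem lookup_ne_none_of_mem {β : Type*} {l : List (ℕ × β)} {p : ℕ} {b : β}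
    (h : (p, b) ∈ l) : l.lookup p ≠ none := by
  induction l with
  | nil => simp at h
  | cons a l ih =>
    rw [List.lookup_cons]
    by_cases hp : p = a.1
    · simp [hp]
    · have h1 : (p == a.1) = false := by simpa using hp
      rw [h1]
      rcases List.mem_cons.1 h with rfl | h
      · exact absurd rfl hp
      · simpa using ih h

end Lookup

theorem record_advance_self (σ : State) (i : ℕ) :
    record (advance σ i) i =
      if tok σ i ∈ σ.2.1 then ((record σ i).1 + 1, 0) else ((record σ i).1, (record σ i).2 + 1) := by
  simp [record, advance]

theorem record_advance_of_ne (σ : State) {i j : ℕ} (h : j ≠ i) :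
    record (advance σ i) j = record σ j := by
  have : (j == i) = false := by simpa using h
  simp [record, advance, List.lookup_cons, this]

@[simp] theorem record_kill (σ : State) (t i : ℕ) : record (kill σ t) i = record σ i := rfl
@[simp] theorem record_assign (σ : State) (p y j i : ℕ) : record (assign σ p y j) i = record σ i := rfl

theorem record_advance_ne (σ : State) (i : ℕ) : record (advance σ i) i ≠ record σ i := by
  rw [record_advance_self]
  intro h
  split_ifs at h
  · have := congrArg Prod.fst h
    simp at this
  · have := congrArg Prod.snd h
    simp at this

theorem tok_inj {σ τ : State} {i j : ℕ} (h : tok σ i = tok τ j) :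
    i = j ∧ (record σ i).1 = (record τ j).1 := by
  simpa [tok, Nat.pair_eq_pair] using h

/-- The candidate of a process depends only on its record. -/
theorem cand_congr {w : ℕ → ℕ → Option ℕ} {σ τ : State} {i : ℕ}
    (h : record σ i = record τ i) : cand w σ i = cand w τ i := by
  simp [cand, tok, h]

theorem tok_congr {σ τ : State} {i : ℕ} (h : record σ i = record τ i) : tok σ i = tok τ i := by
  simp [tok, h]

section Construction

variable {inA : ℕ → ℕ → Bool} {cov : ℕ → ℕ → ℕ → Bool} {dead : ℕ → ℕ → Bool}
  {w : ℕ → ℕ → Option ℕ}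

/-- The possible outcomes of a stage in which process `i` looks at program `p`. -/
inductive Outcome (inA : ℕ → ℕ → Bool) (cov : ℕ → ℕ → ℕ → Bool) (dead : ℕ → ℕ → Bool)
    (w : ℕ → ℕ → Option ℕ) (s : ℕ) (σ : State) (i p : ℕ) : State → Prop
  | adv (h : ∀ y, cand w σ i = some y → inA s y) : Outcome inA cov dead w s σ i p (advance σ i)
  | idle (y : ℕ) (hy : cand w σ i = some y) (hA : ¬ inA s y)
      (h : tok σ i ∈ σ.2.1 ∨ dead s p ∨ ¬ cov s p y) : Outcome inA cov dead w s σ i p σ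
  | block (y : ℕ) (hy : cand w σ i = some y) (hA : ¬ inA s y) (hpi : i ≤ p)
      (h : ∃ a ∈ σ.2.2, a.2.1 = y ∧ a.1 ≤ p) : Outcome inA cov dead w s σ i p σ
  | wait (y y' j : ℕ) (hy : cand w σ i = some y) (h : (p, y', j) ∈ σ.2.2)
      (hj : cand w σ j ≠ some y') :
      Outcome inA cov dead w s σ i p σ
  | small (y : ℕ) (hy : cand w σ i = some y) (ht : tok σ i ∉ σ.2.1) (hd : ¬ dead s p)
      (hc : cov s p y) (hpi : p < i) : Outcome inA cov dead w s σ i p (kill σ (tok σ i))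
  | new (y : ℕ) (hy : cand w σ i = some y) (hc : cov s p y) (hpi : i ≤ p)
      (hb : ∀ a ∈ σ.2.2, a.2.1 = y → p < a.1) (hl : σ.2.2.lookup p = none) :
      Outcome inA cov dead w s σ i p (assign σ p y i)
  | low (y y' j : ℕ) (hy : cand w σ i = some y) (hd : ¬ dead s p)
      (hb : ∀ a ∈ σ.2.2, a.2.1 = y → p < a.1) (h : (p, y', j) ∈ σ.2.2)
      (hj : cand w σ j = some y') (hij : i < j) : Outcome inA cov dead w s σ i p (kill σ (tok σ j))
  | high (y y' j : ℕ) (hy : cand w σ i = some y) (ht : tok σ i ∉ σ.2.1) (hd : ¬ dead s p)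
      (hc : cov s p y) (h : (p, y', j) ∈ σ.2.2)
      (hj : cand w σ j = some y') (hij : j < i) : Outcome inA cov dead w s σ i p (kill σ (tok σ i))

theorem outcome_step (s : ℕ) (σ : State) :
    Outcome inA cov dead w s σ s.unpair.1 s.unpair.2.unpair.1 (step inA cov dead w s σ) := by
  unfold step
  generalize s.unpair.1 = i
  generalize s.unpair.2.unpair.1 = p
  rcases hy : cand w σ i with _ | y
  · exact .adv (by simp [hy])
  simp only [Option.elim_some]
  split_ifs with hA h
  · exact .adv (by simpa [hy] using hA)
  · obtain ⟨ht, hd, hc⟩ := h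
    unfold react
    split_ifs with hpi hb
    · exact .small y hy ht hd hc hpi
    · exact .block y hy hA (not_lt.1 hpi) hb
    · push Not at hb
      rcases hl : σ.2.2.lookup p with _ | ⟨y', j⟩
      · exact .new y hy hc (not_lt.1 hpi) hb hl
      · have hm := mem_of_lookup_eq_some hl
        simp only [Option.elim_some]
        split_ifs with hj hij
        · exact .low y y' j hy hd hb hm hj hij
        · rcases (not_lt.1 hij).lt_or_eq with hlt | rfl
          · exact .high y y' j hy ht hd hc hm hj hlt
          · rw [hy] at hj
            exact absurd (hb _ hm (Option.some.inj hj).symm) (lt_irrefl _)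
        · exact .wait y y' j hy hm hj
  · refine .idle y hy hA ?_
    by_contra hcon
    push Not at hcon
    exact h hcon

theorem outcome_run (s : ℕ) :
    Outcome inA cov dead w s (run inA cov dead w s) s.unpair.1 s.unpair.2.unpair.1
      (run inA cov dead w (s + 1)) :=
  outcome_step s _

theorem exists_stage (i p s₀ : ℕ) :
    ∃ s, s₀ ≤ s ∧ s.unpair.1 = i ∧ s.unpair.2.unpair.1 = p :=
  ⟨Nat.pair i (Nat.pair p s₀), (Nat.right_le_pair _ _).trans (Nat.right_le_pair _ _), by simp,
    by simp⟩

theorem killed_mono {s s' : ℕ} (h : s ≤ s') {t : ℕ} (ht : t ∈ (run inA cov dead w s).2.1) :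
    t ∈ (run inA cov dead w s').2.1 := by
  induction s', h using Nat.le_induction with
  | base => exact ht
  | succ n _ ih =>
    have ho := outcome_run (inA := inA) (cov := cov) (dead := dead) (w := w) n
    generalize run inA cov dead w (n + 1) = τ at *
    cases ho <;>
      simp_all [advance, kill, assign]

theorem assigned_mono {s s' : ℕ} (h : s ≤ s') {a : ℕ × ℕ × ℕ}
    (ha : a ∈ (run inA cov dead w s).2.2) : a ∈ (run inA cov dead w s').2.2 := by
  induction s', h using Nat.le_induction with
  | base => exact ha
  | succ n _ ih =>
    have ho := outcome_run (inA := inA) (cov := cov) (dead := dead) (w := w) n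
    generalize run inA cov dead w (n + 1) = τ at *
    cases ho <;>
      simp_all [advance, kill, assign]

theorem assigned_unique {s : ℕ} {p : ℕ} {b b' : ℕ × ℕ} (h : (p, b) ∈ (run inA cov dead w s).2.2)
    (h' : (p, b') ∈ (run inA cov dead w s).2.2) : b = b' := by
  induction s with
  | zero => simp [run] at h
  | succ n ih =>
    revert h h'
    have ho := outcome_run (inA := inA) (cov := cov) (dead := dead) (w := w) n
    generalize run inA cov dead w (n + 1) = τ at *
    cases ho
    case new y hy hc hpi hb hl =>
      intro h h'
      simp only [assign, List.mem_cons, Prod.mk.injEq] at h h'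
      rcases h with ⟨rfl, rfl⟩ | h <;> rcases h' with ⟨hp, rfl⟩ | h'
      · rfl
      · exact absurd hl (lookup_ne_none_of_mem h')
      · subst hp
        exact absurd hl (lookup_ne_none_of_mem h)
      · exact ih h h'
    all_goals exact ih

theorem covers_of_assigned {s : ℕ} {p y j : ℕ} (h : (p, y, j) ∈ (run inA cov dead w s).2.2) :
    ∃ s', cov s' p y := by
  induction s with
  | zero => simp [run] at h
  | succ n ih =>
    revert h
    have ho := outcome_run (inA := inA) (cov := cov) (dead := dead) (w := w) n
    generalize run inA cov dead w (n + 1) = τ at *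
    cases ho
    case new y hy hc hpi hb hl =>
      intro h
      simp only [assign, List.mem_cons, Prod.mk.injEq] at h
      rcases h with ⟨rfl, rfl, rfl⟩ | h
      · exact ⟨_, hc⟩
      · exact ih h
    all_goals exact ih

theorem cand_of_assigned {s : ℕ} {p y j : ℕ} (h : (p, y, j) ∈ (run inA cov dead w s).2.2) :
    cand w (run inA cov dead w s) j = some y ∨ ∃ s', inA s' y := by
  induction s with
  | zero => simp [run] at h
  | succ n ih =>
    revert h
    have ho := outcome_run (inA := inA) (cov := cov) (dead := dead) (w := w) n
    generalize run inA cov dead w (n + 1) = τ at *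
    cases ho
    case new y hy hc hpi hb hl =>
      intro h
      simp only [assign, List.mem_cons, Prod.mk.injEq] at h
      rcases h with ⟨rfl, rfl, rfl⟩ | h
      · exact .inl hy
      · exact ih h
    case adv hA =>
      intro h
      rcases ih h with h1 | h1
      · by_cases hj : j = n.unpair.1
        · subst hj
          exact .inr ⟨_, hA _ h1⟩
        · left
          rw [← h1, cand, tok, record_advance_of_ne _ hj]
          rfl
      · exact .inr h1
    all_goals exact ih

theorem inA_of_passed (s i : ℕ) {n y : ℕ} (hn : n < (record (run inA cov dead w s) i).2)
    (hy : w (tok (run inA cov dead w s) i) n = some y) : ∃ s', inA s' y := by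
  induction s with
  | zero => simp [run, record] at hn
  | succ m ih =>
    revert hn hy
    have ho := outcome_run (inA := inA) (cov := cov) (dead := dead) (w := w) m
    generalize run inA cov dead w (m + 1) = τ at *
    cases ho
    case adv hA =>
      intro hn hy
      by_cases hi : i = m.unpair.1
      · rw [← hi] at hn hy hA
        rw [tok] at hy
        rw [record_advance_self] at hn hy
        split_ifs at hn hy
        · simp at hn
        · simp only at hn hy
          rcases (Nat.lt_succ_iff.1 hn).lt_or_eq with h | h
          · exact ih h hy
          · subst h
            exact ⟨_, hA _ hy⟩
      · rw [tok] at hy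
        rw [record_advance_of_ne _ hi] at hn hy
        exact ih hn hy
    all_goals exact ih

theorem round_mono {s s' : ℕ} (h : s ≤ s') (i : ℕ) :
    (record (run inA cov dead w s) i).1 ≤ (record (run inA cov dead w s') i).1 := by
  induction s', h using Nat.le_induction with
  | base => exact le_rfl
  | succ n _ ih =>
    refine ih.trans ?_
    have ho := outcome_run (inA := inA) (cov := cov) (dead := dead) (w := w) n
    generalize run inA cov dead w (n + 1) = τ at *
    cases ho
    case adv hA =>
      by_cases hi : i = n.unpair.1
      · subst hi
        rw [record_advance_self]
        split_ifs <;> simp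
      · rw [record_advance_of_ne _ hi]
    all_goals exact le_rfl

/-- Only tokens that are or have been current can be killed. -/
theorem round_le_of_killed {s i k : ℕ} (h : Nat.pair i k ∈ (run inA cov dead w s).2.1) :
    k ≤ (record (run inA cov dead w s) i).1 := by
  induction s with
  | zero => simp [run] at h
  | succ n ih =>
    revert h
    have hm := round_mono (inA := inA) (cov := cov) (dead := dead) (w := w) n.le_succ i
    rw [Nat.succ_eq_add_one] at hm
    revert hm
    have ho := outcome_run (inA := inA) (cov := cov) (dead := dead) (w := w) n
    generalize run inA cov dead w (n + 1) = τ at *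
    cases ho
    case small | low | high =>
      intro hm h
      rcases List.mem_cons.1 h with h | h
      · rw [tok, Nat.pair_eq_pair] at h
        obtain ⟨rfl, rfl⟩ := h
        exact le_rfl
      · exact ih h
    all_goals exact fun hm h => (ih h).trans hm

end Construction
section Settling

/-- The approximations `inA`, `cov` and `dead` are monotone; a program is dead in the limit iff it
covers an element of `A`; each element outside `A` is covered by a program that never dies; and a
token is killed iff all elements of its enumeration are in `A`. -/
structure Coherent (inA : ℕ → ℕ → Bool) (cov : ℕ → ℕ → ℕ → Bool) (dead : ℕ → ℕ → Bool)
    (w : ℕ → ℕ → Option ℕ) : Prop where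
  cov_mono : ∀ {s s' p y}, s ≤ s' → cov s p y → cov s' p y
  inA_mono : ∀ {s s' y}, s ≤ s' → inA s y → inA s' y
  dead_mono : ∀ {s s' p}, s ≤ s' → dead s p → dead s' p
  dead_iff : ∀ p, (∃ s, dead s p) ↔ ∃ y, (∃ s, cov s p y) ∧ ∃ s, inA s y
  exists_cover : ∀ y, (¬ ∃ s, inA s y) → ∃ p, (¬ ∃ s, dead s p) ∧ ∃ s, cov s p y
  killed_iff : ∀ t, (∃ s, t ∈ (run inA cov dead w s).2.1) ↔
    ∀ n y, w t n = some y → ∃ s, inA s y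

variable {inA : ℕ → ℕ → Bool} {cov : ℕ → ℕ → ℕ → Bool} {dead : ℕ → ℕ → Bool}
  {w : ℕ → ℕ → Option ℕ}

/-- Process `i` no longer moves after stage `s₀`. -/
def Settled (inA : ℕ → ℕ → Bool) (cov : ℕ → ℕ → ℕ → Bool) (dead : ℕ → ℕ → Bool)
    (w : ℕ → ℕ → Option ℕ) (i s₀ : ℕ) : Prop :=
  ∀ s, s₀ ≤ s → record (run inA cov dead w s) i = record (run inA cov dead w s₀) i

theorem Settled.run_ne_advance {i s₀ s : ℕ} (h : Settled inA cov dead w i s₀) (hs : s₀ ≤ s) :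
    run inA cov dead w (s + 1) ≠ advance (run inA cov dead w s) i := fun he =>
  record_advance_ne (run inA cov dead w s) i <| by
    rw [← he, h _ hs, h _ (hs.trans s.le_succ)]

theorem Coherent.mem_of_killed (H : Coherent inA cov dead w) {s s' i y : ℕ}
    (hk : tok (run inA cov dead w s) i ∈ (run inA cov dead w s').2.1)
    (hy : cand w (run inA cov dead w s) i = some y) : ∃ s, inA s y :=
  (H.killed_iff _).1 ⟨s', hk⟩ _ _ hy

theorem Coherent.exists_cand (H : Coherent inA cov dead w) {i s₀ : ℕ}
    (h : Settled inA cov dead w i s₀) :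
    ∃ y, cand w (run inA cov dead w s₀) i = some y ∧ (¬ ∃ s, inA s y) ∧
      ∀ s, tok (run inA cov dead w s₀) i ∉ (run inA cov dead w s).2.1 := by
  rcases hy : cand w (run inA cov dead w s₀) i with _ | y
  · obtain ⟨s, hs, hi, -⟩ := exists_stage i 0 s₀
    have hc := (cand_congr (w := w) (h s hs)).trans hy
    have hne := h.run_ne_advance hs
    have ho := outcome_run (inA := inA) (cov := cov) (dead := dead) (w := w) s
    rw [hi] at ho
    generalize run inA cov dead w (s + 1) = τ at ho hne
    cases ho <;> simp_all
  · have hA : ¬ ∃ s, inA s y := by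
      rintro ⟨s₁, hs₁⟩
      obtain ⟨s, hs, hi, -⟩ := exists_stage i 0 (max s₀ s₁)
      have hc := (cand_congr (w := w) (h s ((le_max_left _ _).trans hs))).trans hy
      have hne := h.run_ne_advance ((le_max_left _ _).trans hs)
      have hin := H.inA_mono ((le_max_right _ _).trans hs) hs₁
      obtain ⟨z, hz⟩ : ∃ z, z = run inA cov dead w (s + 1) := ⟨_, rfl⟩
      rw [← hz] at hne
      have hstep : z = step inA cov dead w s (run inA cov dead w s) := hz
      rw [step, hi, hc, Option.elim_some, if_pos hin] at hstep
      exact hne hstep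
    exact ⟨y, rfl, hA, fun s hs => hA (H.mem_of_killed hs hy)⟩

theorem Coherent.exists_assigned (H : Coherent inA cov dead w) {i s₀ y q : ℕ}
    (h : Settled inA cov dead w i s₀) (hy : cand w (run inA cov dead w s₀) i = some y)
    (hq : ∃ s, cov s q y) (hd : ¬ ∃ s, dead s q) :
    i ≤ q ∧ ∃ s, ∃ a ∈ (run inA cov dead w s).2.2, a.2.1 = y ∧ a.1 ≤ q := by
  obtain ⟨s₁, hs₁⟩ := hq
  obtain ⟨y₀, hy₀, hA, hk⟩ := H.exists_cand h
  obtain rfl : y₀ = y := Option.some.inj (hy₀.symm.trans hy)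
  obtain ⟨s, hs, hi, hp⟩ := exists_stage i q (max s₀ s₁)
  have hs0 := (le_max_left _ _).trans hs
  have hc := (cand_congr (w := w) (h s hs0)).trans hy
  have ht := tok_congr (h s hs0)
  have hcov := H.cov_mono ((le_max_right _ _).trans hs) hs₁
  have hne := h.run_ne_advance hs0
  have hks := hk (s + 1)
  have hkill := fun j y => H.mem_of_killed (s := s) (s' := s + 1) (i := j) (y := y)
  have hdead := fun y hc hA => hd ((H.dead_iff q).2 ⟨y, hc, hA⟩)
  have hfin : ∀ τ, τ = run inA cov dead w (s + 1) →
      ∃ s, (run inA cov dead w s).2.2 = τ.2.2 := fun τ hτ => ⟨s + 1, by rw [hτ]⟩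
  have ho := outcome_run (inA := inA) (cov := cov) (dead := dead) (w := w) s
  rw [hi, hp] at ho
  generalize hτ : run inA cov dead w (s + 1) = τ at ho hne hks hkill
  have hτ' := hfin τ hτ.symm
  clear hτ hfin
  cases ho
  case adv => exact absurd rfl hne
  case idle y' hy' hA' h' =>
    obtain rfl : y' = y₀ := Option.some.inj (hy'.symm.trans hc)
    rcases h' with h' | h' | h'
    · exact absurd (ht ▸ h') (hk s)
    · exact absurd ⟨s, h'⟩ hd
    · exact absurd hcov h'
  case block y' hy' hA' hpi h' =>
    obtain rfl : y' = y₀ := Option.some.inj (hy'.symm.trans hc)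
    exact ⟨hpi, s, h'⟩
  case wait y₁ y' j hy₁ h' hj =>
    exact ((hdead y' (covers_of_assigned h') ((cand_of_assigned h').resolve_left hj))).elim
  case small => exact absurd (by rw [← ht]; exact List.mem_cons_self) hks
  case high => exact absurd (by rw [← ht]; exact List.mem_cons_self) hks
  case low y₁ y' j hy₁ hd' hb h' hj hij =>
    exact (hdead y' (covers_of_assigned h') (hkill j y' List.mem_cons_self hj)).elim
  case new y' hy' hc' hpi hb hl =>
    obtain rfl : y' = y₀ := Option.some.inj (hy'.symm.trans hc)
    obtain ⟨s', hs'⟩ := hτ'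
    exact ⟨hpi, s', (q, y', i), by rw [hs']; exact List.mem_cons_self, rfl, le_rfl⟩

/-- From stage `s₁` on, process `j` uses only programs below `B`. -/
def BoundedUse (inA : ℕ → ℕ → Bool) (cov : ℕ → ℕ → ℕ → Bool) (dead : ℕ → ℕ → Bool)
    (w : ℕ → ℕ → Option ℕ) (j B s₁ : ℕ) : Prop :=
  ∀ s, s₁ ≤ s → ∀ y, cand w (run inA cov dead w s) j = some y →
    (∀ p, (p, y, j) ∈ (run inA cov dead w s).2.2 → p < B) ∧
    ∀ p, (∀ a ∈ (run inA cov dead w s).2.2, a.2.1 = y → p < a.1) → p < B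

theorem BoundedUse.mono {j B s B' s' : ℕ} (h : BoundedUse inA cov dead w j B s) (hB : B ≤ B')
    (hs : s ≤ s') : BoundedUse inA cov dead w j B' s' := fun t ht y hy =>
  ⟨fun p hp => ((h t (hs.trans ht) y hy).1 p hp).trans_le hB,
    fun p hp => ((h t (hs.trans ht) y hy).2 p hp).trans_le hB⟩

theorem Coherent.exists_boundedUse (H : Coherent inA cov dead w) {j s₀ : ℕ}
    (h : Settled inA cov dead w j s₀) : ∃ B s₁, BoundedUse inA cov dead w j B s₁ := by
  obtain ⟨y, hy, hA, -⟩ := H.exists_cand h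
  obtain ⟨q, hd, hq⟩ := H.exists_cover y hA
  obtain ⟨-, s₂, a, ha, hay, haq⟩ := H.exists_assigned h hy hq hd
  obtain ⟨B, hB⟩ : ∃ B, ∀ b ∈ (run inA cov dead w (max s₀ s₂)).2.2, b.1 < B := by
    generalize (run inA cov dead w (max s₀ s₂)).2.2 = l
    induction l with
    | nil => simp
    | cons b l ih =>
      obtain ⟨B, hB⟩ := ih
      refine ⟨max B (b.1 + 1), fun c hc => ?_⟩
      rcases List.mem_cons.1 hc with rfl | hc
      · exact lt_max_of_lt_right (Nat.lt_succ_self _)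
      · exact lt_max_of_lt_left (hB c hc)
  have hlt : ∀ s, max s₀ s₂ ≤ s → ∀ p, (∀ b ∈ (run inA cov dead w s).2.2, b.2.1 = y → p < b.1) →
      p < max B (q + 1) := fun s hs p hp =>
    lt_max_of_lt_right (((hp a (assigned_mono ((le_max_right _ _).trans hs) ha) hay).trans_le
      haq).trans (Nat.lt_succ_self _))
  have hmem : ∀ s, max s₀ s₂ ≤ s → ∀ p i, (p, y, i) ∈ (run inA cov dead w s).2.2 →
      p < max B (q + 1) := by
    intro s hs
    induction s, hs using Nat.le_induction with
    | base => exact fun p i hp => lt_max_of_lt_left (hB _ hp)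
    | succ n hn ih =>
      intro p i
      have ho := outcome_run (inA := inA) (cov := cov) (dead := dead) (w := w) n
      generalize run inA cov dead w (n + 1) = τ at ho ⊢
      cases ho
      case new y' hy' hc hpi hb hl =>
        intro hp
        simp only [assign, List.mem_cons, Prod.mk.injEq] at hp
        rcases hp with ⟨rfl, rfl, rfl⟩ | hp
        · exact hlt n hn _ hb
        · exact ih p i hp
      all_goals exact ih p i
  refine ⟨max B (q + 1), max s₀ s₂, fun s hs y' hy' => ?_⟩
  obtain rfl : y = y' := Option.some.inj
    (hy.symm.trans ((cand_congr (h s ((le_max_left _ _).trans hs))).symm.trans hy'))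
  exact ⟨fun p hp => hmem s hs p j hp, hlt s hs⟩

theorem exists_common_boundedUse {i : ℕ}
    (h : ∀ j < i, ∃ B s, BoundedUse inA cov dead w j B s) :
    ∃ B s, ∀ j < i, BoundedUse inA cov dead w j B s := by
  induction i with
  | zero => exact ⟨0, 0, by simp⟩
  | succ i ih =>
    obtain ⟨B, s, hB⟩ := ih fun j hj => h j (hj.trans i.lt_succ_self)
    obtain ⟨B', s', hB'⟩ := h i i.lt_succ_self
    refine ⟨max B B', max s s', fun j hj => ?_⟩
    rcases (Nat.lt_succ_iff.1 hj).lt_or_eq with hj | rfl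
    · exact (hB j hj).mono (le_max_left _ _) (le_max_left _ _)
    · exact hB'.mono (le_max_right _ _) (le_max_right _ _)

/-- When a token of process `i` is killed, a program that is alive and dies later is the reason. -/
theorem Coherent.reason_of_kill (H : Coherent inA cov dead w) {i B s : ℕ} (hiB : i ≤ B)
    (hB : ∀ j < i, BoundedUse inA cov dead w j B s)
    (hk : tok (run inA cov dead w s) i ∉ (run inA cov dead w s).2.1)
    (hk' : tok (run inA cov dead w s) i ∈ (run inA cov dead w (s + 1)).2.1) :
    ∃ p < B, ¬ dead s p ∧ ∃ s', dead s' p := by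
  have hkill := fun y => H.mem_of_killed (s := s) (s' := s + 1) (i := i) (y := y) hk'
  have ho := outcome_run (inA := inA) (cov := cov) (dead := dead) (w := w) s
  generalize run inA cov dead w (s + 1) = τ at ho hk'
  cases ho
  case small y hy ht hd hc hpi =>
    obtain ⟨rfl, -⟩ := tok_inj ((List.mem_cons.1 hk').resolve_right hk)
    exact ⟨_, hpi.trans_le hiB, hd, (H.dead_iff _).2 ⟨y, ⟨s, hc⟩, hkill y hy⟩⟩
  case high y y' j hy ht hd hc h hj hij =>
    obtain ⟨rfl, -⟩ := tok_inj ((List.mem_cons.1 hk').resolve_right hk)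
    exact ⟨_, (hB j hij s le_rfl y' hj).1 _ h, hd, (H.dead_iff _).2 ⟨y, ⟨s, hc⟩, hkill y hy⟩⟩
  case low y y' j hy hd hb h hj hij =>
    obtain ⟨rfl, -⟩ := tok_inj ((List.mem_cons.1 hk').resolve_right hk)
    exact ⟨_, (hB _ hij s le_rfl y hy).2 _ hb, hd,
      (H.dead_iff _).2 ⟨y', covers_of_assigned h, hkill y' hj⟩⟩
  all_goals exact absurd hk' hk

theorem record_succ (s i : ℕ) :
    record (run inA cov dead w (s + 1)) i = record (run inA cov dead w s) i ∨
      run inA cov dead w (s + 1) = advance (run inA cov dead w s) i := by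
  have ho := outcome_run (inA := inA) (cov := cov) (dead := dead) (w := w) s
  generalize run inA cov dead w (s + 1) = τ at ho ⊢
  cases ho
  case adv =>
    by_cases hi : i = s.unpair.1
    · subst hi
      exact .inr rfl
    · exact .inl (record_advance_of_ne _ hi)
  all_goals exact .inl rfl

theorem Coherent.exists_settled (H : Coherent inA cov dead w) (i : ℕ) :
    ∃ s₀, Settled inA cov dead w i s₀ := by
  induction i using Nat.strong_induction_on with
  | _ i ih =>
  obtain ⟨B, s₁, hB⟩ := exists_common_boundedUse fun j hj =>
    (ih j hj).elim fun _ h => H.exists_boundedUse h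
  replace hB : ∀ j < i, BoundedUse inA cov dead w j (max B i) s₁ := fun j hj =>
    (hB j hj).mono (le_max_left _ _) le_rfl
  obtain ⟨S, hS, hdead⟩ : ∃ S, s₁ ≤ S ∧ ∀ p < max B i, (∃ s, dead s p) → dead S p := by
    generalize max B i = N
    induction N with
    | zero => exact ⟨s₁, le_rfl, by simp⟩
    | succ N ihN =>
      obtain ⟨S, hS, hN⟩ := ihN
      by_cases hd : ∃ s, dead s N
      · obtain ⟨s, hs⟩ := hd
        refine ⟨max S s, hS.trans (le_max_left _ _), fun p hp hpd => ?_⟩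
        rcases (Nat.lt_succ_iff.1 hp).lt_or_eq with hp | rfl
        · exact H.dead_mono (le_max_left _ _) (hN p hp hpd)
        · exact H.dead_mono (le_max_right _ _) hs
      · refine ⟨S, hS, fun p hp hpd => ?_⟩
        rcases (Nat.lt_succ_iff.1 hp).lt_or_eq with hp | rfl
        · exact hN p hp hpd
        · exact absurd hpd hd
  have hnokill : ∀ s, S ≤ s → tok (run inA cov dead w s) i ∉ (run inA cov dead w s).2.1 →
      tok (run inA cov dead w s) i ∉ (run inA cov dead w (s + 1)).2.1 := by
    intro s hs hk hk'
    obtain ⟨p, hp, hd, hd'⟩ := H.reason_of_kill (le_max_right _ _)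
      (fun j hj => (hB j hj).mono le_rfl (hS.trans hs)) hk hk'
    exact hd (H.dead_mono hs (hdead p hp hd'))
  by_contra hns
  push Not at hns
  have hmove : ∀ s₀, ∃ s, s₀ ≤ s ∧
      record (run inA cov dead w s) i ≠ record (run inA cov dead w s₀) i := by
    intro s₀
    have := hns s₀
    unfold Settled at this
    push Not at this
    exact this
  obtain ⟨s₂, hs₂, hk₂⟩ : ∃ s₂, S ≤ s₂ ∧
      tok (run inA cov dead w s₂) i ∉ (run inA cov dead w s₂).2.1 := by
    by_contra hall
    push Not at hall
    obtain ⟨s, hs, hne⟩ := hmove S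
    refine hne ?_
    clear hne
    induction s, hs using Nat.le_induction with
    | base => rfl
    | succ n hn ihn =>
      rcases record_succ (inA := inA) (cov := cov) (dead := dead) (w := w) n i with h | h
      · rw [h, ihn]
      · exfalso
        have h1 := hall (n + 1) (hn.trans n.le_succ)
        have h2 := hall n hn
        rw [h, tok, record_advance_self, if_pos h2] at h1
        have := round_le_of_killed (inA := inA) (cov := cov) (dead := dead) (w := w) h1
        omega
  have hstep : ∀ s, s₂ ≤ s →
      ((record (run inA cov dead w s) i).1 = (record (run inA cov dead w s₂) i).1 ∧
        tok (run inA cov dead w s) i ∉ (run inA cov dead w s).2.1) ∧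
      (record (run inA cov dead w s) i).2 ≤ (record (run inA cov dead w (s + 1)) i).2 := by
    have hle : ∀ s, tok (run inA cov dead w s) i ∉ (run inA cov dead w s).2.1 →
        (record (run inA cov dead w (s + 1)) i).1 = (record (run inA cov dead w s) i).1 ∧
        (record (run inA cov dead w s) i).2 ≤ (record (run inA cov dead w (s + 1)) i).2 := by
      intro s hk
      rcases record_succ (inA := inA) (cov := cov) (dead := dead) (w := w) s i with h | h
      · rw [h]
        exact ⟨rfl, le_rfl⟩
      · rw [h, record_advance_self, if_neg hk]
        exact ⟨rfl, Nat.le_succ _⟩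
    intro s hs
    have key : (record (run inA cov dead w s) i).1 = (record (run inA cov dead w s₂) i).1 ∧
        tok (run inA cov dead w s) i ∉ (run inA cov dead w s).2.1 := by
      induction s, hs using Nat.le_induction with
      | base => exact ⟨rfl, hk₂⟩
      | succ n hn ihn =>
        refine ⟨(hle n ihn.2).1.trans ihn.1, ?_⟩
        rw [tok, (hle n ihn.2).1, ← tok]
        exact hnokill n (hs₂.trans hn) ihn.2
    exact ⟨key, (hle s key.2).2⟩
  have hmono : ∀ s, s₂ ≤ s → ∀ s', s ≤ s' →
      (record (run inA cov dead w s) i).2 ≤ (record (run inA cov dead w s') i).2 := by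
    intro s hs s' hs'
    induction s', hs' using Nat.le_induction with
    | base => exact le_rfl
    | succ n hn ihn => exact ihn.trans (hstep n (hs.trans hn)).2
  have hunb : ∀ N, ∃ s, s₂ ≤ s ∧ N ≤ (record (run inA cov dead w s) i).2 := by
    intro N
    induction N with
    | zero => exact ⟨s₂, le_rfl, Nat.zero_le _⟩
    | succ N ihN =>
      obtain ⟨s, hs, hN⟩ := ihN
      obtain ⟨s', hs', hne⟩ := hmove s
      refine ⟨s', hs.trans hs', Nat.succ_le_of_lt (hN.trans_lt ((hmono s hs s' hs').lt_of_ne ?_))⟩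
      intro h2
      exact hne (Prod.ext ((hstep s' (hs.trans hs')).1.1.trans (hstep s hs).1.1.symm) h2.symm)
  have htok : ∀ s, s₂ ≤ s → tok (run inA cov dead w s) i = tok (run inA cov dead w s₂) i :=
    fun s hs => by rw [tok, (hstep s hs).1.1, ← tok]
  obtain ⟨s, hs⟩ := (H.killed_iff (tok (run inA cov dead w s₂) i)).2 fun n y hy => by
    obtain ⟨s, hs, hn⟩ := hunb (n + 1)
    exact inA_of_passed s i hn ((htok s hs).symm ▸ hy)
  refine (hstep (max s₂ s) (le_max_left _ _)).1.2 ?_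
  rw [htok _ (le_max_left _ _)]
  exact killed_mono (le_max_right _ _) hs

theorem Coherent.exists_hard (H : Coherent inA cov dead w) (i : ℕ) :
    ∃ y p j s, (¬ ∃ s, inA s y) ∧ (p, y, j) ∈ (run inA cov dead w s).2.2 ∧
      ∀ q, (∃ s, cov s q y) → (¬ ∃ s, dead s q) → p ≤ q ∧ i ≤ q := by
  classical
  obtain ⟨s₀, h⟩ := H.exists_settled i
  obtain ⟨y, hy, hA, -⟩ := H.exists_cand h
  have hex : ∃ p, ∃ j s, (p, y, j) ∈ (run inA cov dead w s).2.2 := by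
    obtain ⟨q, hd, hq⟩ := H.exists_cover y hA
    obtain ⟨-, s, ⟨p, y', j⟩, ha, rfl, -⟩ := H.exists_assigned h hy hq hd
    exact ⟨p, j, s, ha⟩
  obtain ⟨j, s, hp⟩ := Nat.find_spec hex
  refine ⟨y, Nat.find hex, j, s, hA, hp, fun q hq hd => ?_⟩
  obtain ⟨hiq, s', ⟨p', y', j'⟩, ha, rfl, hle⟩ := H.exists_assigned h hy hq hd
  exact ⟨(Nat.find_min' hex ⟨j', s', ha⟩).trans hle, hiq⟩

end Settling
section Effective

open Primrec

variable {γ δ : Type*} [Primcodable γ] [Primcodable δ]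

theorem primrec_optionElim {α σ : Type*} [Primcodable α] [Primcodable σ] {o : δ → Option α}
    {f : δ → σ} {g : δ → α → σ} (ho : Primrec o) (hf : Primrec f) (hg : Primrec₂ g) :
    Primrec fun a => (o a).elim (f a) (g a) :=
  (option_casesOn ho hf hg).of_eq fun a => by cases o a <;> rfl

theorem primrecRel_mem {α : Type*} [Primcodable α] :
    PrimrecRel fun (a : α) (l : List α) => a ∈ l :=
  ((PrimrecRel.exists_mem_list Primrec.eq).comp snd fst).of_eq fun a => by simp

theorem primrec_record {σ : δ → State} {i : δ → ℕ} (hσ : Primrec σ) (hi : Primrec i) :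
    Primrec fun a => record (σ a) (i a) :=
  option_getD.comp (listLookup.comp hi (fst.comp hσ)) (const (0, 0))

theorem primrec_tok {σ : δ → State} {i : δ → ℕ} (hσ : Primrec σ) (hi : Primrec i) :
    Primrec fun a => tok (σ a) (i a) :=
  Primrec₂.natPair.comp hi (fst.comp (primrec_record hσ hi))

theorem primrec_advance {σ : δ → State} {i : δ → ℕ} (hσ : Primrec σ) (hi : Primrec i) :
    Primrec fun a => advance (σ a) (i a) := by
  have hr := primrec_record hσ hi
  exact ((list_cons.comp (hi.pair (Primrec.ite
    (primrecRel_mem.comp (primrec_tok hσ hi) (fst.comp (snd.comp hσ)))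
    ((Primrec.succ.comp (fst.comp hr)).pair (const 0))
    ((fst.comp hr).pair (Primrec.succ.comp (snd.comp hr))))) (fst.comp hσ)).pair (snd.comp hσ))

theorem primrec_kill {σ : δ → State} {t : δ → ℕ} (hσ : Primrec σ) (ht : Primrec t) :
    Primrec fun a => kill (σ a) (t a) :=
  (fst.comp hσ).pair ((list_cons.comp ht (fst.comp (snd.comp hσ))).pair (snd.comp (snd.comp hσ)))

theorem primrec_assign {σ : δ → State} {p y i : δ → ℕ} (hσ : Primrec σ) (hp : Primrec p)
    (hy : Primrec y) (hi : Primrec i) : Primrec fun a => assign (σ a) (p a) (y a) (i a) :=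
  (fst.comp hσ).pair ((fst.comp (snd.comp hσ)).pair
    (list_cons.comp (hp.pair (hy.pair hi)) (snd.comp (snd.comp hσ))))

theorem primrec_cand {w : γ → ℕ → ℕ → Option ℕ}
    (hw : Primrec fun a : γ × ℕ × ℕ => w a.1 a.2.1 a.2.2) {c : δ → γ} {σ : δ → State} {i : δ → ℕ}
    (hc : Primrec c) (hσ : Primrec σ) (hi : Primrec i) :
    Primrec fun a => cand (w (c a)) (σ a) (i a) :=
  hw.comp (hc.pair ((primrec_tok hσ hi).pair (snd.comp (primrec_record hσ hi))))

theorem primrec_react {w : γ → ℕ → ℕ → Option ℕ}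
    (hw : Primrec fun a : γ × ℕ × ℕ => w a.1 a.2.1 a.2.2) {c : δ → γ} {σ : δ → State}
    {i p y : δ → ℕ} (hc : Primrec c) (hσ : Primrec σ) (hi : Primrec i) (hp : Primrec p)
    (hy : Primrec y) : Primrec fun a => react (w (c a)) (σ a) (i a) (p a) (y a) := by
  have hblock : PrimrecRel fun (a : ℕ × ℕ × ℕ) (b : ℕ × ℕ) => a.2.1 = b.1 ∧ a.1 ≤ b.2 :=
    (Primrec.eq.comp (fst.comp (snd.comp fst)) (fst.comp snd)).and
      (nat_le.comp (fst.comp fst) (snd.comp snd))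
  have hpair : Primrec fun x : δ × (ℕ × ℕ) => x.2 := snd
  refine Primrec.ite (nat_lt.comp hp hi) (primrec_kill hσ (primrec_tok hσ hi)) <|
    Primrec.ite (hblock.exists_mem_list.comp (snd.comp (snd.comp hσ)) (hy.pair hp)) hσ <|
    primrec_optionElim (listLookup.comp hp (snd.comp (snd.comp hσ))) (primrec_assign hσ hp hy hi)
      (Primrec.ite (Primrec.eq.comp
        (primrec_cand hw (hc.comp fst) (hσ.comp fst) (snd.comp hpair))
        (option_some.comp (fst.comp hpair)))
        (primrec_kill (hσ.comp fst) (Primrec.ite (nat_lt.comp (hi.comp fst) (snd.comp hpair))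
          (primrec_tok (hσ.comp fst) (snd.comp hpair))
          (primrec_tok (hσ.comp fst) (hi.comp fst))))
        (hσ.comp fst))

theorem primrec_run {inA : ℕ → ℕ → Bool} {cov : ℕ → ℕ → ℕ → Bool} {dead : ℕ → ℕ → Bool}
    {w : γ → ℕ → ℕ → Option ℕ} (hA : Primrec₂ inA)
    (hcov : Primrec fun a : ℕ × ℕ × ℕ => cov a.1 a.2.1 a.2.2) (hdead : Primrec₂ dead)
    (hw : Primrec fun a : γ × ℕ × ℕ => w a.1 a.2.1 a.2.2) :
    Primrec₂ fun (c : γ) s => run inA cov dead (w c) s := by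
  have hstep : Primrec₂ fun (c : γ) (b : ℕ × State) => step inA cov dead (w c) b.1 b.2 := by
    have hc : Primrec fun x : γ × (ℕ × State) => x.1 := fst
    have hs : Primrec fun x : γ × (ℕ × State) => x.2.1 := fst.comp snd
    have hσ : Primrec fun x : γ × (ℕ × State) => x.2.2 := snd.comp snd
    have hi := fst.comp (unpair.comp hs)
    have hp := fst.comp (unpair.comp (snd.comp (unpair.comp hs)))
    have hy : Primrec fun x : (γ × (ℕ × State)) × ℕ => x.2 := snd
    refine primrec_optionElim (primrec_cand hw hc hσ hi) (primrec_advance hσ hi) <|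
      Primrec.ite (Primrec.eq.comp (hA.comp (hs.comp fst) hy) (const true))
        ((primrec_advance hσ hi).comp fst) <|
      Primrec.ite ?_ (primrec_react hw (hc.comp fst) (hσ.comp fst) (hi.comp fst) (hp.comp fst) hy)
        (hσ.comp fst)
    exact (((primrecRel_mem (α := ℕ)).comp ((primrec_tok hσ hi).comp fst)
      ((fst.comp (snd.comp hσ)).comp fst)).not).and
      ((Primrec.eq.comp (hdead.comp (hs.comp fst) (hp.comp fst)) (const true)).not.and
        (Primrec.eq.comp (hcov.comp ((hs.comp fst).pair ((hp.comp fst).pair hy))) (const true)))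
  exact nat_rec (const (([], [], []) : State)) hstep

end Effective

section Strings

theorem primrec_strNum : Primrec strNum := by
  refine Primrec.list_foldl (f := fun x : List Bool => x) (g := fun _ => 0)
    (h := fun _ b => 2 * b.1 + 1 + b.2.toNat) .id (.const 0) ?_
  refine Primrec.nat_add.comp (Primrec.succ.comp (Primrec.nat_mul.comp (.const 2)
    (Primrec.fst.comp Primrec.snd))) ((Primrec.dom_bool Bool.toNat).comp
      (Primrec.snd.comp Primrec.snd))

/-- The binary string with a given position in the length-lexicographic order. -/
noncomputable def numStr : ℕ → List Bool := (Equiv.ofBijective strNum strNum_bijective).symm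

@[simp] theorem strNum_numStr (n : ℕ) : strNum (numStr n) = n :=
  (Equiv.ofBijective strNum strNum_bijective).apply_symm_apply n

@[simp] theorem numStr_strNum (x : List Bool) : numStr (strNum x) = x :=
  (Equiv.ofBijective strNum strNum_bijective).symm_apply_apply x

theorem computable_numStr : Computable numStr := by
  let f : ℕ → ℕ → Option (List Bool) := fun n k =>
    (Encodable.decode (α := List Bool) k).bind fun x => if strNum x = n then some x else none
  have hf : Primrec₂ f :=
    Primrec.option_bind (Primrec.decode.comp Primrec.snd)
      (Primrec.ite (Primrec.eq.comp (primrec_strNum.comp Primrec.snd)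
        (Primrec.fst.comp Primrec.fst)) (Primrec.option_some.comp Primrec.snd) (.const none))
  refine (Partrec.rfindOpt hf.to_comp).of_eq_tot fun n => ?_
  have hfn : ∀ {k x}, x ∈ f n k → x = numStr n := by
    intro k x hx
    simp only [f, Option.mem_def, Option.bind_eq_some_iff] at hx
    obtain ⟨z, -, hz⟩ := hx
    split_ifs at hz with h
    rw [← Option.some.inj hz, ← h, numStr_strNum]
  have hdom : (Nat.rfindOpt (f n)).Dom :=
    Nat.rfindOpt_dom.2 ⟨Encodable.encode (numStr n), numStr n, by simp [f]⟩
  obtain ⟨x, hx⟩ := Part.dom_iff_mem.1 hdom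
  obtain ⟨k, hk⟩ := Nat.rfindOpt_spec hx
  rwa [← hfn hk]

theorem strNum_add_one_lt (x : List Bool) : strNum x + 1 < 2 ^ (x.length + 1) := by
  induction x using List.reverseRecOn with
  | nil => simp [strNum]
  | append_singleton x b ih =>
    rw [strNum_append_singleton, List.length_append, List.length_singleton, pow_succ]
    have := Bool.toNat_le b
    omega

theorem two_pow_length_le (x : List Bool) : 2 ^ x.length ≤ strNum x + 1 := by
  induction x using List.reverseRecOn with
  | nil => simp [strNum]
  | append_singleton x b ih =>
    rw [strNum_append_singleton, List.length_append, List.length_singleton, pow_succ]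
    omega

theorem length_le_of_strNum_le {x y : List Bool} (h : strNum x ≤ strNum y) :
    x.length ≤ y.length := by
  have h1 := two_pow_length_le x
  have h2 := strNum_add_one_lt y
  exact Nat.lt_succ_iff.1 ((Nat.pow_lt_pow_iff_right (a := 2) (by norm_num)).1 (by omega))

end Strings

section Numbers

open Nat.Partrec (Code)

/-- Domains of partial recursive functions have codes. -/
theorem exists_code_eval {f : ℕ →. ℕ} (hf : Partrec f) : ∃ c : Code, Code.eval c = f :=
  Code.exists_code.1 (Partrec.nat_iff.1 hf)

theorem dom_eval_iff {c : Code} {n : ℕ} :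
    (Code.eval c n).Dom ↔ ∃ s, (Code.evaln s c n).isSome := by
  simp only [Part.dom_iff_mem, Option.isSome_iff_exists, Code.evaln_complete, Option.mem_def]
  exact exists_comm

theorem isSome_evaln_mono {c : Code} {n s s' : ℕ} (hs : s ≤ s')
    (h : (Code.evaln s c n).isSome) : (Code.evaln s' c n).isSome := by
  obtain ⟨x, hx⟩ := Option.isSome_iff_exists.1 h
  exact Option.isSome_iff_exists.2 ⟨x, Code.evaln_mono hs hx⟩

/-- By the recursion theorem, the enumerations used by the construction can be chosen such that
the killed tokens are exactly those whose enumeration stays inside `S`. -/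
theorem exists_killed_iff {inA : ℕ → ℕ → Bool} {cov : ℕ → ℕ → ℕ → Bool} {dead : ℕ → ℕ → Bool}
    (hA : Primrec₂ inA) (hcov : Primrec fun a : ℕ × ℕ × ℕ => cov a.1 a.2.1 a.2.2)
    (hdead : Primrec₂ dead) {g : ℕ → ℕ} (hg : Computable g) {S : Set ℕ}
    (hS : ∀ e, e ∈ diagK ↔ reSet (g e) ⊆ S) :
    ∃ w : ℕ → ℕ → Option ℕ, (Primrec₂ fun (_ : Unit) s => run inA cov dead w s) ∧
      ∀ t, (∃ s, t ∈ (run inA cov dead w s).2.1) ↔ ∀ n y, w t n = some y → y ∈ S := by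
  let tc : Code → ℕ → ℕ := fun c t => Encodable.encode (Code.comp c (Code.const t))
  have htc : Primrec₂ tc := Primrec.encode.comp
    (Code.primrec₂_comp.comp Primrec.fst (Code.primrec_const.comp Primrec.snd))
  let G : ℕ →. ℕ := fun v => Code.eval
    (Denumerable.ofNat Code (g (tc (Denumerable.ofNat Code v.unpair.1) v.unpair.2.unpair.1)))
    v.unpair.2.unpair.2
  have hfst : Primrec fun v : ℕ => v.unpair.1 := Primrec.fst.comp Primrec.unpair
  have hsnd : Primrec fun v : ℕ => v.unpair.2 := Primrec.snd.comp Primrec.unpair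
  have hG : Partrec G := Code.eval_part.comp
    ((Computable.ofNat Code).comp (hg.comp (htc.comp ((Primrec.ofNat Code).comp hfst)
      (hfst.comp hsnd)).to_comp)) (hsnd.comp hsnd).to_comp
  obtain ⟨cG, hcG⟩ := exists_code_eval hG
  let w : Code → ℕ → ℕ → Option ℕ := fun c t n =>
    if (Code.evaln n.unpair.2 cG (Nat.pair (Encodable.encode c) (Nat.pair t n.unpair.1))).isSome
    then some n.unpair.1 else none
  have hw : Primrec fun a : Code × ℕ × ℕ => w a.1 a.2.1 a.2.2 := by
    have hn : Primrec fun a : Code × ℕ × ℕ => a.2.2 := Primrec.snd.comp Primrec.snd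
    refine Primrec.ite (Primrec.eq.comp (Primrec.option_isSome.comp
      (Code.primrec_evaln.comp (((hsnd.comp hn).pair (.const cG)).pair
        (Primrec₂.natPair.comp (Primrec.encode.comp Primrec.fst)
          (Primrec₂.natPair.comp (Primrec.fst.comp Primrec.snd) (hfst.comp hn))))))
      (.const true)) (Primrec.option_some.comp (hfst.comp hn)) (.const none)
  have hrun := primrec_run hA hcov hdead hw
  let K : Code → ℕ →. ℕ := fun c t =>
    Nat.rfind fun s => Part.some (decide (t ∈ (run inA cov dead (w c) s).2.1))
  have hK : Partrec₂ K := by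
    refine Partrec.rfind (Computable.partrec ?_)
    have h : PrimrecPred fun a : (Code × ℕ) × ℕ =>
        a.1.2 ∈ (run inA cov dead (w a.1.1) a.2).2.1 :=
      primrecRel_mem.comp (Primrec.snd.comp Primrec.fst) (Primrec.fst.comp (Primrec.snd.comp
        (hrun.comp (Primrec.fst.comp Primrec.fst) Primrec.snd)))
    exact h.decide.to_comp
  obtain ⟨c, hc⟩ := Code.fixed_point₂ hK
  refine ⟨w c, hrun.comp (.const c) Primrec.snd, fun t => ?_⟩
  have h1 : (∃ s, t ∈ (run inA cov dead (w c) s).2.1) ↔ (Code.eval c t).Dom := by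
    have hct : Code.eval c t =
        Nat.rfind fun s => Part.some (decide (t ∈ (run inA cov dead (w c) s).2.1)) := congrFun hc t
    rw [hct]
    refine Iff.trans ?_ Nat.rfind_dom.symm
    constructor
    · rintro ⟨s, hs⟩
      exact ⟨s, by simpa using hs, fun _ => trivial⟩
    · rintro ⟨s, hs, -⟩
      exact ⟨s, by simpa using hs⟩
  have h2 : (Code.eval c t).Dom ↔ tc c t ∈ diagK := by
    have (m : ℕ) : Code.eval (Code.comp c (Code.const t)) m = Code.eval c t := by
      change ((Code.const t).eval m).bind (Code.eval c) = _
      rw [Code.eval_const]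
      exact Part.bind_some _ _
    simp [diagK, reSet, tc, this]
  have h3 : ∀ y, y ∈ reSet (g (tc c t)) ↔ ∃ n, w c t n = some y := by
    intro y
    have : y ∈ reSet (g (tc c t)) ↔
        (Code.eval cG (Nat.pair (Encodable.encode c) (Nat.pair t y))).Dom := by
      simp [hcG, G, reSet]
    rw [this, dom_eval_iff]
    constructor
    · rintro ⟨s, hs⟩
      exact ⟨Nat.pair y s, by simp [w, hs]⟩
    · rintro ⟨n, hn⟩
      simp only [w] at hn
      split_ifs at hn with h
      rw [Option.some.injEq] at hn
      exact ⟨_, hn ▸ h⟩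
  rw [h1, h2, hS]
  exact ⟨fun h n y hy => h ((h3 y).2 ⟨n, hy⟩), fun h y hy =>
    ((h3 y).1 hy).elim fun n hn => h n y hn⟩

end Numbers
section Main

open Nat.Partrec (Code)

theorem chi_of_notMem {A : Set (List Bool)} {x : List Bool} (hx : x ∉ A) : chi A x = [false] := by
  simp [chi, hx]

theorem chi_of_mem {A : Set (List Bool)} {x : List Bool} (hx : x ∈ A) : chi A x = [true] := by
  simp [chi, hx]

/-- Instances outside `A` have a consistent program for an optimal interpreter. -/
theorem exists_consistent_program {U : Interpreter} (hU : IsOptimal U) {A : Set (List Bool)}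
    {x : List Bool} (hx : x ∉ A) : ∃ p, IsConsistent A (U p) ∧ some [false] ∈ U p x := by
  let V : Interpreter := fun p z => Part.some (if z = p then some [false] else none)
  have hV : Partrec₂ V := Computable.partrec
    (Primrec.ite (Primrec.eq.comp Primrec.snd Primrec.fst) (.const (some [false]))
      (.const none)).to_comp
  obtain ⟨c, hc⟩ := hU.2 V hV
  have h1 : weakInstComplexity V A x ≤ x.length := by
    refine iInf₂_le x ⟨fun z v hv => ?_, ?_⟩
    · rw [Part.mem_some_iff] at hv
      split_ifs at hv with hz
      · left
        rw [hv, hz, chi_of_notMem hx]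
      · exact .inr hv
    · rw [chi_of_notMem hx, Part.mem_some_iff, if_pos rfl]
  have h2 : weakInstComplexity U A x ≤ ((x.length + c : ℕ) : ℕ∞) := by
    refine (hc x A).2.2.trans ?_
    push_cast
    gcongr
  by_contra hno
  push Not at hno
  have : weakInstComplexity U A x = ⊤ := by
    refine iInf₂_eq_top.2 fun p hp => ?_
    have := hp.2
    rw [chi_of_notMem hx] at this
    exact absurd this (hno p hp.1)
  rw [this, top_le_iff] at h2
  exact ENat.natCast_ne_top _ h2

/-- The approximations to `A` and to the interpreter `U`. -/
theorem exists_approximation {U : Interpreter} (hU : Partrec₂ U) {A : Set (List Bool)}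
    (hA : REPred fun x => x ∈ A) :
    ∃ (inA : ℕ → ℕ → Bool) (cov : ℕ → ℕ → ℕ → Bool),
      Primrec₂ inA ∧ (Primrec fun a : ℕ × ℕ × ℕ => cov a.1 a.2.1 a.2.2) ∧
      (∀ {s s' y}, s ≤ s' → inA s y → inA s' y) ∧
      (∀ {s s' p y}, s ≤ s' → cov s p y → cov s' p y) ∧
      (∀ y, (∃ s, inA s y) ↔ numStr y ∈ A) ∧
      ∀ p y, (∃ s, cov s p y) ↔ some [false] ∈ U (numStr p) (numStr y) := by
  let f : ℕ →. ℕ := fun n => Part.assert (numStr n ∈ A) fun _ => Part.some 0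
  have hf : Partrec f :=
    (Partrec.map (hA.comp computable_numStr) (Computable.const 0).to₂).of_eq fun n => by
      ext
      simp [f, eq_comm]
  obtain ⟨cA, hcA⟩ := exists_code_eval hf
  let u : ℕ →. ℕ := fun v =>
    (U (numStr v.unpair.1) (numStr v.unpair.2)).map Encodable.encode
  have hu : Partrec u := (hU.comp (computable_numStr.comp (Computable.fst.comp .unpair))
    (computable_numStr.comp (Computable.snd.comp .unpair))).map
      (Computable.encode.comp Computable.snd).to₂
  obtain ⟨cU, hcU⟩ := exists_code_eval hu
  refine ⟨fun s y => (Code.evaln s cA y).isSome, fun s p y =>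
    decide (Code.evaln s cU (Nat.pair p y) = some (Encodable.encode (some [false]))),
    ?_, ?_, fun hs h => isSome_evaln_mono hs h, fun hs h => ?_, fun y => ?_, fun p y => ?_⟩
  · exact Primrec.option_isSome.comp
      (Code.primrec_evaln.comp ((Primrec.fst.pair (.const cA)).pair Primrec.snd))
  · have : PrimrecPred fun a : ℕ × ℕ × ℕ => Code.evaln a.1 cU (Nat.pair a.2.1 a.2.2) =
        some (Encodable.encode (some [false])) :=
      Primrec.eq.comp (Code.primrec_evaln.comp ((Primrec.fst.pair (.const cU)).pair
        (Primrec₂.natPair.comp (Primrec.fst.comp Primrec.snd) (Primrec.snd.comp Primrec.snd))))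
        (.const _)
    exact this.decide
  · rw [decide_eq_true_eq] at h ⊢
    exact Code.evaln_mono hs h
  · rw [← dom_eval_iff, hcA]
    exact ⟨fun h => h.1, fun h => ⟨h, trivial⟩⟩
  · simp only [decide_eq_true_eq]
    rw [← exists_congr fun s => Option.mem_def, ← Code.evaln_complete, hcU]
    simp only [u, Nat.unpair_pair, Part.mem_map_iff, Encodable.encode_inj, exists_eq_right]

theorem hasWeakHardInstances {U : Interpreter} (hU : IsOptimal U) {A : Set (List Bool)}
    (hA : IsQComplete A) : HasWeakHardInstances U A := by
  obtain ⟨hre, g, hg, hgK⟩ := hA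
  obtain ⟨inA, cov, hpA, hpc, inA_mono, cov_mono, inA_iff, cov_iff⟩ :=
    exists_approximation hU.1 hre
  let dead : ℕ → ℕ → Bool := fun s p =>
    decide (∃ y ∈ List.range s, cov s p y = true ∧ inA s y = true)
  have hpd : Primrec₂ dead := by
    have hrel : PrimrecRel fun (y : ℕ) (a : ℕ × ℕ) => cov a.1 a.2 y = true ∧ inA a.1 y = true :=
      (Primrec.eq.comp (hpc.comp ((Primrec.fst.comp Primrec.snd).pair
        ((Primrec.snd.comp Primrec.snd).pair Primrec.fst))) (.const true)).and
      (Primrec.eq.comp (hpA.comp (Primrec.fst.comp Primrec.snd) Primrec.fst) (.const true))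
    exact (hrel.exists_mem_list.comp (Primrec.list_range.comp Primrec.fst) .id).decide
  obtain ⟨w, hrun, hkill⟩ := exists_killed_iff hpA hpc hpd hg hgK
  have hmemA : ∀ y, y ∈ strNum '' A ↔ ∃ s, inA s y := fun y => by
    rw [inA_iff]
    exact ⟨fun ⟨x, hx, h⟩ => by rwa [← h, numStr_strNum], fun h => ⟨_, h, strNum_numStr y⟩⟩
  have hdead_iff : ∀ p, (∃ s, dead s p) ↔ ∃ y, (∃ s, cov s p y) ∧ ∃ s, inA s y := by
    intro p
    constructor
    · rintro ⟨s, hs⟩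
      obtain ⟨y, -, hc, hy⟩ := of_decide_eq_true hs
      exact ⟨y, ⟨s, hc⟩, s, hy⟩
    · rintro ⟨y, ⟨s, hs⟩, s', hs'⟩
      refine ⟨max (y + 1) (max s s'), decide_eq_true ⟨y, ?_, ?_, ?_⟩⟩
      · simp
      · exact cov_mono ((le_max_left _ _).trans (le_max_right _ _)) hs
      · exact inA_mono ((le_max_right _ _).trans (le_max_right _ _)) hs'
  have hcons : ∀ {q : List Bool}, IsConsistent A (U q) → ¬ ∃ s, dead s (strNum q) := by
    intro q hq hd
    obtain ⟨y, hc, hy⟩ := (hdead_iff _).1 hd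
    rw [cov_iff, numStr_strNum] at hc
    rw [inA_iff] at hy
    have := hq _ _ hc
    simp [chi_of_mem hy] at this
  have H : Coherent inA cov dead w :=
    { cov_mono := cov_mono
      inA_mono := inA_mono
      dead_mono := fun {s s' p} hs h => by
        obtain ⟨y, hy, hc, hA⟩ := of_decide_eq_true h
        rw [List.mem_range] at hy
        exact decide_eq_true
          ⟨y, List.mem_range.2 (hy.trans_le hs), cov_mono hs hc, inA_mono hs hA⟩
      dead_iff := hdead_iff
      exists_cover := fun y hy => by
        rw [inA_iff] at hy
        obtain ⟨q, hq, hqy⟩ := exists_consistent_program hU hy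
        exact ⟨strNum q, hcons hq, (cov_iff _ _).2 (by rwa [numStr_strNum])⟩
      killed_iff := fun t => by
        rw [hkill]
        simp only [hmemA] }
  let V : Interpreter := fun p _ => Nat.rfindOpt fun s =>
    ((run inA cov dead w s).2.2.lookup (strNum p)).map fun b => some (numStr b.1)
  have hV : Partrec₂ V := by
    refine Partrec.rfindOpt (Computable.option_map
      (f := fun a : (List Bool × List Bool) × ℕ =>
        (run inA cov dead w a.2).2.2.lookup (strNum a.1.1)) ?_ ?_)
    · exact (Primrec.listLookup.comp (primrec_strNum.comp (Primrec.fst.comp Primrec.fst))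
        (Primrec.snd.comp (Primrec.snd.comp (hrun.comp (.const ()) Primrec.snd)))).to_comp
    · exact Computable.option_some.comp
        (computable_numStr.comp (Computable.fst.comp Computable.snd))
  have hVmem : ∀ {p y j s}, (p, y, j) ∈ (run inA cov dead w s).2.2 →
      some (numStr y) ∈ V (numStr p) [] := by
    intro p y j s h
    have hdom : (V (numStr p) []).Dom := by
      obtain ⟨b, hb⟩ := Option.ne_none_iff_exists'.1 (lookup_ne_none_of_mem h)
      exact Nat.rfindOpt_dom.2 ⟨s, some (numStr b.1), by simp [hb]⟩
    obtain ⟨x, hx⟩ := Part.dom_iff_mem.1 hdom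
    obtain ⟨s', hs'⟩ := Nat.rfindOpt_spec hx
    rw [Option.mem_def, Option.map_eq_some_iff] at hs'
    obtain ⟨b, hb, rfl⟩ := hs'
    have hb' := mem_of_lookup_eq_some hb
    rw [strNum_numStr] at hb'
    have := assigned_unique (assigned_mono (le_max_left s s') h)
      (assigned_mono (le_max_right s s') hb')
    rwa [← this] at hx
  obtain ⟨c, hc⟩ := hU.2 V hV
  have hprog : ∀ x, ∃ q, x ∉ A → IsConsistent A (U q) ∧ some [false] ∈ U q x := fun x => by
    by_cases hx : x ∈ A
    · exact ⟨[], fun h => absurd hx h⟩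
    · exact (exists_consistent_program hU hx).imp fun q hq _ => hq
  choose Q hQ using hprog
  refine ⟨c, Set.Infinite.of_image (fun x => strNum (Q x)) (Set.infinite_of_not_bddAbove ?_)⟩
  rintro ⟨N, hN⟩
  obtain ⟨y, p, j, s, hy, hp, hmin⟩ := H.exists_hard (N + 1)
  rw [inA_iff] at hy
  have hmin' : ∀ q, IsConsistent A (U q) → some [false] ∈ U q (numStr y) →
      p ≤ strNum q ∧ N + 1 ≤ strNum q := fun q hq hqy =>
    hmin _ ((cov_iff _ _).2 (by rwa [numStr_strNum])) (hcons hq)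
  have hhard : kolmogorov U (numStr y) ≤ weakInstComplexity U A (numStr y) + c := by
    refine (hc (numStr y) A).1.trans ?_
    gcongr
    refine (iInf₂_le (numStr p) (hVmem hp)).trans (le_iInf₂ fun q hq => ?_)
    rw [Set.mem_ofPred_eq, chi_of_notMem hy] at hq
    have := (hmin' q hq.1 hq.2).1
    exact_mod_cast length_le_of_strNum_le (by rwa [strNum_numStr])
  have h1 := hN ⟨numStr y, hhard, rfl⟩
  have h2 := (hmin' _ (hQ _ hy).1 (hQ _ hy).2).2
  simp only at h1
  omega

theorem weakInstComplexity_le_instComplexity (U : Interpreter) (A : Set (List Bool))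
    (x : List Bool) : weakInstComplexity U A x ≤ instComplexity U A x :=
  le_iInf₂ fun p hp => iInf₂_le p ⟨hp.2.1, hp.2.2⟩

theorem HasWeakHardInstances.hasHardInstances {U : Interpreter} {A : Set (List Bool)}
    (h : HasWeakHardInstances U A) : HasHardInstances U A := by
  obtain ⟨c, hc⟩ := h
  refine ⟨c, hc.mono ?_⟩
  intro x hx
  rw [Set.mem_ofPred_eq] at hx ⊢
  refine hx.trans ?_
  gcongr
  exact weakInstComplexity_le_instComplexity U A x

end Main
end InstanceComplexity

theorem mainTheorem6 (U : Interpreter) (hU : IsOptimal U) (A : Set (List Bool))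
    (hA : IsQComplete A) : HasHardInstances U A ∧ HasWeakHardInstances U A :=
  have h := InstanceComplexity.hasWeakHardInstances hU hA
  ⟨InstanceComplexity.HasWeakHardInstances.hasHardInstances h, h⟩
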